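/- Let $A$ be an Artin algebra, i.e. an algebra over a commutative artinian ring $R$ which is finitely generated as an $R$-module, and let $n\ge 2$. Let $A$-mod be the category of finitely generated left $A$-modules, and let $\mathrm{Mor}_n(A)$ be the abelian category whose objects $X=X_{(\phi_i)}$ are sequences $X_n\xrightarrow{\phi_{n-1}}X_{n-1}\to\cdots\xrightarrow{\phi_1}X_1$ in $A$-mod and whose morphisms are commutative ladders; it is identified with the category $T_n(A)$-mod of finitely generated left modules over the $n\times n$ upper triangular matrix algebra $T_n(A)$. For an object $Y$ of one of these two abelian categories let ${}^\perp Y$ be the full subcategory of all $X$ with $\operatorname{Ext}^i(X,Y)=0$ for all $i\ge 1$. For a full subcategory $\mathcal X$ of $A$-mod let $\mathcal S_n(\mathcal X)$ be the full subcategory of $\mathrm{Mor}_n(A)$ of all $X_{(\phi_i)}$ such that $X_i\in\mathcal X$ for $1\le i\le n$, and $\phi_i$ is a monomorphism with $\operatorname{Coker}\phi_i\in\mathcal X$ for $1\le i\le n-1$. For $M\in A$-mod and $1\le i\le n$ let $\mathbf m_i(M)\in \mathrm{Mor}_n(A)$ be the object whose $j$-th term is $M$ for $j\le i$ and $0$ for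 $j>i$, and let $\mathbf p_i(M)$ be the object whose $j$-th term is $M$ for $j\ge n-i+1$ and $0$ for $j<n-i+1$; in both, the maps between consecutive terms equal to $M$ are identities and all other maps are $0$. Put $\mathbf m(M)=\bigoplus_{i=1}^n\mathbf m_i(M)$ and $\mathbf p(M)=\bigoplus_{i=1}^n\mathbf p_i(M)$. Finally let $D(A_A)=\operatorname{Hom}_R(A,E)$, where $E$ is an injective envelope of the $R$-module $R/\operatorname{rad}R$, with the left $A$-module structure $(af)(x)=f(xa)$. Proposition 3.6. For an arbitrary $T\in A$-mod, $$\mathcal S_n({}^\perp T)={}^\perp\mathbf m(T)\cap{}^\perp\mathbf p(T)\cap{}^\perp\mathbf m(D(A_A)).$$ -/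

import Mathlib

open CategoryTheory CategoryTheory.Limits

universe u v

/-! ### Left perpendicular categories in an abelian category -/

/-- The full subcategory `^⊥Y` of an abelian category: all `X` with `Ext^i(X, Y) = 0` for every
`i ≥ 1`. Here `Ext` is the Ext-group of the abelian category, formed in a universe in which it
always exists (its vanishing does not depend on that universe). -/
def leftPerp {C : Type u} [Category.{v} C] [Abelian C] (Y : C) : ObjectProperty C := fun X =>
  haveI : HasExt.{max u v} C := HasExt.standard C
  ∀ i : ℕ, 1 ≤ i → Subsingleton (Abelian.Ext.{max u v} X Y i)

/-! ### The morphism category and the monomorphism category -/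

/-- The morphism category `Mor_n` of a category `C`: sequences
`X_n ⟶ ⋯ ⟶ X_2 ⟶ X_1` of `n` objects and `n - 1` composable morphisms of `C`, with commutative
ladders as morphisms, written as contravariant functors on the chain `Fin n`.
The branches are indexed from `0`: the `(j + 1)`-st branch is the value at `j : Fin n`. -/
abbrev MorCat (n : ℕ) (C : Type u) [Category.{v} C] := (Fin n)ᵒᵖ ⥤ C

namespace MorCat

variable {n : ℕ} {C : Type u} [Category.{v} C]

/-- The `(j + 1)`-st branch of `X`. -/
abbrev branch (X : MorCat n C) (j : ℕ) (hj : j < n) : C := X.obj (Opposite.op ⟨j, hj⟩)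

/-- The `(j + 1)`-st morphism `X_{j+2} ⟶ X_{j+1}` of `X`. -/
abbrev mor (X : MorCat n C) (j : ℕ) (hj : j + 1 < n) :
    X.branch (j + 1) hj ⟶ X.branch j (Nat.lt_of_succ_lt hj) :=
  X.map (homOfLE (Fin.mk_le_mk.mpr (Nat.le_succ j))).op

/-- The monomorphism category `S_n(𝒳)` of a full subcategory `𝒳`: all branches lie in `𝒳`, all
morphisms of the sequence are monomorphisms, and all their cokernels lie in `𝒳`. -/
def monoCat [Abelian C] (n : ℕ) (P : ObjectProperty C) : ObjectProperty (MorCat n C) := fun X =>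
  (∀ (j : ℕ) (hj : j < n), P (X.branch j hj)) ∧
    ∀ (j : ℕ) (hj : j + 1 < n), Mono (X.mor j hj) ∧ P (cokernel (X.mor j hj))

open scoped ZeroObject Classical in
/-- The object of `Mor_n` whose branches are `M` at the places of an interval `S` and `0` at the
other places; its structure morphisms are the identity of `M` between two places of `S`, and `0`
otherwise. (`eqToHom` only unfolds the case distinction defining the branches.) -/
noncomputable def constOn [Abelian C] (S : Set (Fin n)) [hS : S.OrdConnected] (M : C) :
    MorCat n C where
  obj j := if j.unop ∈ S then M else 0
  map {k j} _ :=
    if h : k.unop ∈ S ∧ j.unop ∈ S then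
      eqToHom (if_pos h.1) ≫ 𝟙 M ≫ eqToHom (if_pos h.2).symm
    else 0
  map_id k := by
    by_cases h : k.unop ∈ S
    · simp [h]
    · rw [dif_neg (by simp [h])]
      exact (IsZero.of_iso (isZero_zero C) (eqToIso (if_neg h))).eq_of_src _ _
  map_comp {k l j} f g := by
    by_cases hk : k.unop ∈ S <;> by_cases hj : j.unop ∈ S
    · have hl : l.unop ∈ S := hS.out hj hk ⟨leOfHom g.unop, leOfHom f.unop⟩
      simp [hk, hj, hl]
    all_goals simp [hk, hj]

/-- `m_i(M)`: the `j`-th branch is `M` for `j ≤ i` and `0` for `j > i`. -/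
noncomputable def mAt [Abelian C] (i : Fin n) (M : C) : MorCat n C := constOn (Set.Iic i) M

/-- `p_i(M)`: with branches and `i` numbered from `1` to `n`, the `j`-th branch is `M` for
`j ≥ n - i + 1` and `0` for `j < n - i + 1`. Numbered from `0`, the place `n - i + 1` is
`Fin.rev i`. -/
noncomputable def pAt [Abelian C] (i : Fin n) (M : C) : MorCat n C := constOn (Set.Ici i.rev) M

/-- `m(M)`, the direct sum of `m_i(M)` over all `i`. -/
noncomputable def mSum [Abelian C] (n : ℕ) (M : C) : MorCat n C :=
  haveI : HasFiniteBiproducts (MorCat n C) := Abelian.hasFiniteBiproducts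
  ⨁ fun i : Fin n => mAt i M

/-- `p(M)`, the direct sum of `p_i(M)` over all `i`. -/
noncomputable def pSum [Abelian C] (n : ℕ) (M : C) : MorCat n C :=
  haveI : HasFiniteBiproducts (MorCat n C) := Abelian.hasFiniteBiproducts
  ⨁ fun i : Fin n => pAt i M

end MorCat

/-! ### The duality of an Artin algebra, applied to the regular right module -/

/-- `ι : M → E` is an injective envelope: `E` is injective, `ι` is injective, and the image of `ι`
is an essential submodule of `E`. -/
structure IsInjectiveEnvelope {R M E : Type u} [Ring R] [AddCommGroup M] [Module R M]
    [AddCommGroup E] [Module R E] (ι : M →ₗ[R] E) : Prop where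
  isInjective : Module.Injective R E
  injective : Function.Injective ι
  essential : ∀ N : Submodule R E, N ≠ ⊥ → N ⊓ LinearMap.range ι ≠ ⊥

/-- The group `Hom_R(A, E)`, to be regarded as a left `A`-module through the right action of `A` on
itself. -/
def DualRegular (R A E : Type u) [CommRing R] [Ring A] [Algebra R A] [AddCommGroup E]
    [Module R E] : Type u := A →ₗ[R] E

namespace DualRegular

variable (R A E : Type u) [CommRing R] [Ring A] [Algebra R A] [AddCommGroup E] [Module R E]

instance : AddCommGroup (DualRegular R A E) := inferInstanceAs (AddCommGroup (A →ₗ[R] E))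

/-- The left `A`-module structure `(a • f)(x) = f (x * a)`. -/
instance : Module A (DualRegular R A E) where
  smul a f := LinearMap.comp (show A →ₗ[R] E from f) (LinearMap.mulRight R a)
  one_smul f := LinearMap.ext fun x => congrArg (show A →ₗ[R] E from f) (mul_one x)
  mul_smul a b f := LinearMap.ext fun x =>
    congrArg (show A →ₗ[R] E from f) (mul_assoc x a b).symm
  smul_zero _ := rfl
  smul_add _ _ _ := rfl
  add_smul a b f := LinearMap.ext fun x =>
    (congrArg (show A →ₗ[R] E from f) (mul_add x a b)).trans (map_add (show A →ₗ[R] E from f) _ _)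
  zero_smul f := LinearMap.ext fun x =>
    (congrArg (show A →ₗ[R] E from f) (mul_zero x)).trans (map_zero (show A →ₗ[R] E from f))

end DualRegular

/-- The socle step: an injective envelope of `R / rad R` has finitely generated `rad R`-torsion. -/
theorem IsInjectiveEnvelope.isNoetherian_torsion {R E : Type u} [CommRing R] [IsArtinianRing R]
    [AddCommGroup E] [Module R E] {ι : (R ⧸ Ring.jacobson R) →ₗ[R] E}
    (hι : IsInjectiveEnvelope ι) :
    IsNoetherian R (Submodule.torsionBySet R E (Ring.jacobson R : Set R)) := by
  set S := Submodule.torsionBySet R E (Ring.jacobson R : Set R) with hS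
  have hle : LinearMap.range ι ≤ S := by
    rintro _ ⟨x, rfl⟩
    rw [hS, Submodule.mem_torsionBySet_iff]
    rintro ⟨r, hr⟩
    obtain ⟨x, rfl⟩ := Ideal.Quotient.mk_surjective x
    rw [← map_smul]
    have : r • (Ideal.Quotient.mk (Ring.jacobson R) x) = 0 :=
      Ideal.Quotient.eq_zero_iff_mem.mpr (Ideal.mul_mem_right _ _ hr)
    rw [this, map_zero]
  have hss : IsSemisimpleModule R S :=
    (Submodule.torsionBySet_isTorsionBySet (R := R) (M := E)
      (s := (Ring.jacobson R : Set R))).isSemisimpleModule_iff.mp inferInstance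
  obtain ⟨N, hN⟩ := exists_isCompl ((LinearMap.range ι).submoduleOf S)
  have hbot : N.map S.subtype = ⊥ := by
    by_contra hne
    apply hι.essential _ hne
    rw [eq_bot_iff]
    rintro _ ⟨⟨y, hy, rfl⟩, hr⟩
    have : y ∈ (LinearMap.range ι).submoduleOf S ⊓ N := ⟨hr, hy⟩
    rw [hN.inf_eq_bot, Submodule.mem_bot] at this
    simp [this]
  have hN0 : N = ⊥ := (Submodule.map_injective_of_injective S.injective_subtype) (by rw [hbot, Submodule.map_bot])
  have htop : (LinearMap.range ι).submoduleOf S = ⊤ := by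
    have := hN.sup_eq_top
    rwa [hN0, sup_bot_eq] at this
  have hSle : S ≤ LinearMap.range ι := Submodule.submoduleOf_eq_top.mp htop
  have : IsNoetherian R (LinearMap.range ι) := inferInstance
  exact isNoetherian_of_le hSle

/-- An injective envelope of `R / rad R` over a commutative artinian ring is finitely generated. -/
theorem IsInjectiveEnvelope.finite {R E : Type u} [CommRing R] [IsArtinianRing R]
    [AddCommGroup E] [Module R E] {ι : (R ⧸ Ring.jacobson R) →ₗ[R] E}
    (hι : IsInjectiveEnvelope ι) : Module.Finite R E := by
  have h1 := hι.isNoetherian_torsion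
  set J := Ring.jacobson R with hJ
  have key : ∀ k : ℕ, IsNoetherian R (Submodule.torsionBySet R E ((J ^ k : Ideal R) : Set R)) := by
    intro k
    induction k with
    | zero =>
      have : Submodule.torsionBySet R E ((J ^ 0 : Ideal R) : Set R) = ⊥ := by
        rw [pow_zero, Ideal.one_eq_top, Submodule.top_coe, Submodule.torsionBySet_univ]
      rw [this]
      infer_instance
    | succ k ih =>
      obtain ⟨s, hs⟩ := (isNoetherianRing_iff_ideal_fg R).mp inferInstance (J ^ k)
      let g : Submodule.torsionBySet R E ((J ^ (k + 1) : Ideal R) : Set R) →ₗ[R]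
          (s → Submodule.torsionBySet R E (J : Set R)) :=
        LinearMap.pi fun r => LinearMap.codRestrict _
          ((r : R) • (Submodule.subtype _)) (by
            rintro ⟨x, hx⟩
            rw [Submodule.mem_torsionBySet_iff] at hx ⊢
            rintro ⟨a, ha⟩
            have hr : (r : R) ∈ J ^ k := hs ▸ Ideal.subset_span r.2
            have := hx ⟨(r : R) * a, by rw [pow_succ]; exact Ideal.mul_mem_mul hr ha⟩
            simpa [smul_smul, mul_comm] using this)
      refine isNoetherian_of_range_eq_ker
        (Submodule.inclusion (Submodule.torsionBySet_le_torsionBySet_pow (R := R) (M := E)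
          k (k + 1) (Nat.le_succ k) J)) g ?_
      rw [Submodule.range_inclusion]
      ext ⟨x, hx⟩
      rw [Submodule.mem_comap, LinearMap.mem_ker, ← hs]
      change x ∈ Submodule.torsionBySet R E ((Ideal.span (s : Set R) : Ideal R) : Set R) ↔ _
      rw [← Submodule.torsionBySet_eq_torsionBySet_span, Submodule.mem_torsionBySet_iff]
      constructor
      · intro h
        funext r
        exact Subtype.ext (h r)
      · intro h r
        exact congrArg Subtype.val (congrFun h r)
  obtain ⟨k, hk⟩ : IsNilpotent J := IsSemiprimaryRing.isNilpotent
  have h := key k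
  have htop : Submodule.torsionBySet R E ((J ^ k : Ideal R) : Set R) = ⊤ := by
    rw [hk, eq_top_iff]
    intro x _
    rw [Submodule.mem_torsionBySet_iff]
    rintro ⟨a, ha⟩
    have ha : a = 0 := ha
    simp [ha]
  rw [htop] at h
  have : IsNoetherian R E := isNoetherian_of_linearEquiv (Submodule.topEquiv (R := R) (M := E))
  infer_instance

/-- The `A`-module `D(A_A) = Hom_R(A, E)` is finitely generated, where `E` is an injective envelope
of `R / rad R`. -/
theorem DualRegular.finite {R A E : Type u} [CommRing R] [IsArtinianRing R] [Ring A] [Algebra R A]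
    [Module.Finite R A] [AddCommGroup E] [Module R E] {ι : (R ⧸ Ring.jacobson R) →ₗ[R] E}
    (hι : IsInjectiveEnvelope ι) : Module.Finite A (DualRegular R A E) := by
  have := hι.finite
  obtain ⟨s, hs⟩ : (⊤ : Submodule R (A →ₗ[R] E)).FG := Module.Finite.fg_top
  let t : Finset (DualRegular R A E) := s
  have key : ∀ f : A →ₗ[R] E, f ∈ Submodule.span R (s : Set (A →ₗ[R] E)) →
      (show DualRegular R A E from f) ∈ Submodule.span A (t : Set (DualRegular R A E)) := by
    intro f hf
    induction hf using Submodule.span_induction with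
    | mem x hx => exact Submodule.subset_span hx
    | zero => exact Submodule.zero_mem _
    | add x y _ _ hx hy => exact Submodule.add_mem _ hx hy
    | smul r x _ hx =>
      have : (show DualRegular R A E from r • x) =
          algebraMap R A r • (show DualRegular R A E from x) := by
        refine LinearMap.ext fun y => ?_
        change r • x y = x (y * algebraMap R A r)
        rw [← Algebra.commutes, ← Algebra.smul_def, map_smul]
      rw [this]
      exact Submodule.smul_mem _ _ hx
  exact ⟨⟨t, eq_top_iff.mpr fun f _ => key f (hs ▸ Submodule.mem_top)⟩⟩

/-- The finitely generated left `A`-module `D(A_A)` of an Artin `R`-algebra `A`, where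
`D = Hom_R(-, E)` for an injective envelope `E` of `R / rad R`. -/
noncomputable def dualRegular {R : Type u} (A : Type u) {E : Type u} [CommRing R]
    [IsArtinianRing R] [Ring A] [Algebra R A] [Module.Finite R A] [AddCommGroup E] [Module R E]
    {ι : (R ⧸ Ring.jacobson R) →ₗ[R] E} (hι : IsInjectiveEnvelope ι) : FGModuleCat.{u} A :=
  haveI := DualRegular.finite (A := A) hι
  FGModuleCat.of A (DualRegular R A E)

/-- An Artin algebra is a left noetherian ring. -/
theorem isNoetherianRing_of_artinAlgebra (R A : Type u) [CommRing R] [IsArtinianRing R] [Ring A]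
    [Algebra R A] [Module.Finite R A] : IsNoetherianRing A :=
  isNoetherian_of_tower R (inferInstanceAs (IsNoetherian R A))

-- Write `constOn (Set.Ici j) M` for the object with `M` from place `j` on. It is right adjoint to
-- evaluation at `j`, and evaluation is exact, so perpendicularity to it is perpendicularity of the
-- branch at `j` to `M` (`leftPerp_constOn_Ici_iff`). Hence `^⊥p(T)` says exactly that all branches
-- lie in `^⊥T`. For a place `j` with successor `j'`, `m_j(M)` is the kernel of the epimorphism from
-- the constant object to `constOn (Set.Ici j') M`. If the branches of `X` lie in `^⊥M`, the long
-- exact sequence leaves one condition: maps from the branch at `j'` to `M` extend along the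
-- composite to the branch at `0`. Over all `j` this says that maps to `M` extend along every
-- structure morphism (`leftPerp_mSum_iff`). For `M = D(A_A)`, an injective cogenerator, this means
-- that the structure morphisms are monomorphisms. For `M = T` and a monomorphism between objects of
-- `^⊥T`, it means that the cokernel lies in `^⊥T`.

universe w w'

namespace CategoryTheory

/-! ### Vanishing of Ext as an extension or lifting property. -/

section ExtVanishing

open Abelian

variable {C : Type u} [Category.{v} C]

/-- Every morphism from `X` to `T` extends along `f : X ⟶ Y`. -/
def ExtendsAlong (T : C) {X Y : C} (f : X ⟶ Y) : Prop :=
  ∀ g : X ⟶ T, ∃ h : Y ⟶ T, f ≫ h = g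

lemma ExtendsAlong.comp {T X Y Z : C} {f : X ⟶ Y} {g : Y ⟶ Z} (hf : ExtendsAlong T f)
    (hg : ExtendsAlong T g) : ExtendsAlong T (f ≫ g) := fun a => by
  obtain ⟨b, rfl⟩ := hf a
  obtain ⟨c, rfl⟩ := hg b
  exact ⟨c, Category.assoc _ _ _⟩

lemma ExtendsAlong.of_comp {T X Y Z : C} {f : X ⟶ Y} {g : Y ⟶ Z}
    (h : ExtendsAlong T (f ≫ g)) : ExtendsAlong T f := fun a => by
  obtain ⟨b, rfl⟩ := h a
  exact ⟨g ≫ b, (Category.assoc _ _ _).symm⟩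

variable [Abelian C] [HasExt.{w} C]

variable {S : ShortComplex C} (hS : S.ShortExact)

-- The connecting map `Hom(S.X₁, Y) → Ext¹(S.X₃, Y)` is onto, and its kernel consists of the maps
-- that extend to `S.X₂`.
include hS in
lemma subsingleton_ext_one_iff_extendsAlong {Y : C} (h : Subsingleton (Ext.{w} S.X₂ Y 1)) :
    Subsingleton (Ext.{w} S.X₃ Y 1) ↔ ExtendsAlong Y S.f := by
  constructor
  · intro h3 g
    obtain ⟨x, hx⟩ := Ext.contravariant_sequence_exact₁ hS Y (Ext.mk₀ g) (add_zero 1)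
      (Subsingleton.elim _ _)
    obtain ⟨x, rfl⟩ := (Ext.mk₀_bijective _ _).2 x
    rw [Ext.mk₀_comp_mk₀] at hx
    exact ⟨x, (Ext.mk₀_bijective _ _).1 hx⟩
  · intro hext
    refine subsingleton_of_forall_eq 0 fun x => ?_
    obtain ⟨y, rfl⟩ := Ext.contravariant_sequence_exact₃ hS Y x (Subsingleton.elim _ _)
      (add_zero 1)
    obtain ⟨y, rfl⟩ := (Ext.mk₀_bijective _ _).2 y
    obtain ⟨z, rfl⟩ := hext y
    rw [← Ext.mk₀_comp_mk₀, hS.extClass_comp_assoc]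

include hS in
lemma subsingleton_ext_succ_iff {Y : C} {k k' : ℕ} (hk : 1 + k = k')
    (h : Subsingleton (Ext.{w} S.X₂ Y k)) (h' : Subsingleton (Ext.{w} S.X₂ Y k')) :
    Subsingleton (Ext.{w} S.X₃ Y k') ↔ Subsingleton (Ext.{w} S.X₁ Y k) := by
  constructor
  · intro h3
    refine subsingleton_of_forall_eq 0 fun x => ?_
    obtain ⟨y, rfl⟩ := Ext.contravariant_sequence_exact₁ hS Y x hk (Subsingleton.elim _ _)
    rw [Subsingleton.elim y 0, Ext.comp_zero]
  · intro h1
    refine subsingleton_of_forall_eq 0 fun x => ?_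
    obtain ⟨y, rfl⟩ := Ext.contravariant_sequence_exact₃ hS Y x (Subsingleton.elim _ _) hk
    rw [Subsingleton.elim y 0, Ext.comp_zero]

end ExtVanishing

end CategoryTheory

namespace leftPerp

open Abelian

variable {C : Type u} [Category.{v} C] [Abelian C]

lemma of_injective (X I : C) [Injective I] : leftPerp I X := by
  let : HasExt.{max u v} C := HasExt.standard C
  intro k hk
  obtain ⟨k, rfl⟩ := Nat.exists_eq_add_of_le' hk
  exact Ext.subsingleton_of_injective X I k

/-- Dimension shifting settles all degrees from 2 on, so only the obstruction in degree 1 remains.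
-/
lemma iff_extendsAlong {S : ShortComplex C} (hS : S.ShortExact) {Y : C}
    (h₁ : leftPerp Y S.X₁) (h₂ : leftPerp Y S.X₂) :
    leftPerp Y S.X₃ ↔ ExtendsAlong Y S.f := by
  let : HasExt.{max u v} C := HasExt.standard C
  rw [← subsingleton_ext_one_iff_extendsAlong hS (h₂ 1 le_rfl)]
  refine ⟨fun h => h 1 le_rfl, fun h k hk => ?_⟩
  obtain rfl | hk := hk.eq_or_lt
  · exact h
  · obtain ⟨k, rfl⟩ := Nat.exists_eq_add_of_le hk.le
    exact (subsingleton_ext_succ_iff hS rfl (h₂ k (by lia)) (h₂ _ (by lia))).2 (h₁ k (by lia))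

/-- In the covariant sequence, Ext of the kernel term is squeezed to zero in degrees from 2 on; in
degree 1 it is the cokernel of `Hom(X, S.X₂) → Hom(X, S.X₃)`. -/
lemma iff_lifts {S : ShortComplex C} (hS : S.ShortExact) {X : C}
    (h₂ : leftPerp S.X₂ X) (h₃ : leftPerp S.X₃ X) :
    leftPerp S.X₁ X ↔ ∀ g : X ⟶ S.X₃, ∃ h : X ⟶ S.X₂, h ≫ S.g = g := by
  let : HasExt.{max u v} C := HasExt.standard C
  constructor
  · intro h g
    have := h 1 le_rfl
    obtain ⟨x, hx⟩ := Ext.covariant_sequence_exact₃ X hS (Ext.mk₀ g) (zero_add 1)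
      (Subsingleton.elim _ _)
    obtain ⟨x, rfl⟩ := (Ext.mk₀_bijective _ _).2 x
    rw [Ext.mk₀_comp_mk₀] at hx
    exact ⟨x, (Ext.mk₀_bijective _ _).1 hx⟩
  · intro hl k hk
    have := h₂ k hk
    refine subsingleton_of_forall_eq 0 fun x => ?_
    obtain ⟨k, rfl⟩ := Nat.exists_eq_add_of_le' hk
    obtain ⟨y, rfl⟩ := Ext.covariant_sequence_exact₁ X hS x (Subsingleton.elim _ _) rfl
    cases k with
    | zero =>
      obtain ⟨y, rfl⟩ := (Ext.mk₀_bijective _ _).2 y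
      obtain ⟨z, rfl⟩ := hl y
      rw [← Ext.mk₀_comp_mk₀, Ext.comp_assoc_of_second_deg_zero, hS.comp_extClass, Ext.comp_zero]
    | succ k =>
      have := h₃ (k + 1) (by lia)
      rw [Subsingleton.elim y 0, Ext.zero_comp]

lemma biproduct_iff {J : Type*} [Fintype J] (Y : J → C) [HasBiproduct Y] (X : C) :
    leftPerp (⨁ Y) X ↔ ∀ j, leftPerp (Y j) X := by
  let : HasExt.{max u v} C := HasExt.standard C
  have e (k : ℕ) := (Ext.addEquivBiproduct X (biproduct.isBilimit Y) k).toEquiv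
  constructor
  · intro h j k hk
    have := h k hk
    have := (e k).symm.subsingleton
    classical
    refine subsingleton_of_forall_eq 0 fun x => ?_
    have := congrFun (Subsingleton.elim (Pi.single j x : ∀ i, Ext X (Y i) k) 0) j
    simpa using this
  · intro h k hk
    have := fun j => h j k hk
    exact (e k).subsingleton

end leftPerp

/-! ### Interval objects as adjoints to evaluation, and the resulting comparison of Ext. -/

namespace MorCat

open Opposite

variable {n : ℕ} {C : Type u} [Category.{v} C]

/-- The structure morphism `X_k ⟶ X_j` for `j ≤ k`. -/
abbrev trans (X : MorCat n C) {j k : Fin n} (h : j ≤ k) : X.obj (op k) ⟶ X.obj (op j) :=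
  X.map (homOfLE h).op

section ConstOn

variable [Abelian C] {S : Set (Fin n)} [S.OrdConnected] {M : C}

variable (S M) in
/-- The branches of `constOn S M` at the places of `S` are `M`. -/
noncomputable def constOnIso {k : Fin n} (h : k ∈ S) : (constOn S M).obj (op k) ≅ M :=
  eqToIso (if_pos h)

lemma isZero_constOn_obj {k : Fin n} (h : k ∉ S) : IsZero ((constOn S M).obj (op k)) :=
  IsZero.of_iso (isZero_zero C) (eqToIso (if_neg h))

lemma constOn_map {k j : Fin n} (hk : k ∈ S) (hj : j ∈ S) (f : op k ⟶ op j) :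
    (constOn S M).map f = (constOnIso S M hk).hom ≫ (constOnIso S M hj).inv := by
  simp [constOn, constOnIso, hk, hj]

lemma constOn_congr {S' : Set (Fin n)} [S'.OrdConnected] (h : S = S') :
    constOn S M = constOn S' M := by
  subst h
  rfl

lemma projective_constOn_obj [Projective M] (k : (Fin n)ᵒᵖ) :
    Projective ((constOn S M).obj k) := by
  by_cases h : k.unop ∈ S
  · exact Projective.of_iso (constOnIso S M h).symm inferInstance
  · exact (isZero_constOn_obj h).projective

end ConstOn

section UniversalProperties

variable [Abelian C] {j : Fin n} {M : C}

/-- Together with `hom_constOn_Ici_ext`, this is the adjunction bijection `Hom(X, constOn (Set.Ici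
j) M) ≃ Hom(X_j, M)`: at `k ≥ j` the morphism must be `X_k ⟶ X_j ⟶ M`. -/
lemma exists_hom_constOn_Ici {X : MorCat n C} (f : X.obj (op j) ⟶ M) :
    ∃ g : X ⟶ constOn (Set.Ici j) M,
      g.app (op j) ≫ (constOnIso (Set.Ici j) M (Set.self_mem_Ici)).hom = f := by
  classical
  refine ⟨{
    app k := if h : j ≤ k.unop then X.trans h ≫ f ≫ (constOnIso (Set.Ici j) M h).inv else 0
    naturality := ?_ }, ?_⟩
  · rintro ⟨k⟩ ⟨l⟩ a
    by_cases hl : j ≤ l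
    · have hk : j ≤ k := hl.trans (leOfHom a.unop)
      rw [dif_pos hl, dif_pos hk, constOn_map hk hl, Category.assoc, Category.assoc,
        Iso.inv_hom_id_assoc, trans, trans, ← Functor.map_comp_assoc]
      rfl
    · exact (isZero_constOn_obj hl).eq_of_tgt _ _
  · simp [trans]

lemma hom_constOn_Ici_ext {X : MorCat n C} {f g : X ⟶ constOn (Set.Ici j) M}
    (h : f.app (op j) = g.app (op j)) : f = g := by
  ext ⟨k⟩
  by_cases hk : k ∈ Set.Ici j
  · have hf := f.naturality (homOfLE hk).op
    have hg := g.naturality (homOfLE hk).op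
    rw [constOn_map hk Set.self_mem_Ici] at hf hg
    rw [h, hg] at hf
    exact ((cancel_mono _).1 hf).symm
  · exact (isZero_constOn_obj hk).eq_of_tgt _ _

/-- Dually, `constOn (Set.Iic j)` is left adjoint to evaluation at `j`, and therefore preserves
projectives. -/
lemma exists_constOn_Iic_hom {X : MorCat n C} (f : M ⟶ X.obj (op j)) :
    ∃ g : constOn (Set.Iic j) M ⟶ X,
      (constOnIso (Set.Iic j) M (Set.self_mem_Iic)).inv ≫ g.app (op j) = f := by
  classical
  refine ⟨{
    app k := if h : k.unop ≤ j then (constOnIso (Set.Iic j) M h).hom ≫ f ≫ X.trans h else 0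
    naturality := ?_ }, ?_⟩
  · rintro ⟨k⟩ ⟨l⟩ a
    by_cases hk : k ≤ j
    · have hl : l ≤ j := le_trans (leOfHom a.unop) hk
      rw [dif_pos hl, dif_pos hk, constOn_map hk hl, Category.assoc, Category.assoc,
        Iso.inv_hom_id_assoc, Category.assoc, trans, trans, ← Functor.map_comp]
      rfl
    · exact (isZero_constOn_obj hk).eq_of_src _ _
  · simp [trans]

lemma constOn_Iic_hom_ext {X : MorCat n C} {f g : constOn (Set.Iic j) M ⟶ X}
    (h : f.app (op j) = g.app (op j)) : f = g := by
  ext ⟨k⟩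
  by_cases hk : k ∈ Set.Iic j
  · have hf := f.naturality (homOfLE hk).op
    have hg := g.naturality (homOfLE hk).op
    rw [constOn_map Set.self_mem_Iic hk] at hf hg
    rw [h, ← hg] at hf
    exact (cancel_epi _).1 hf
  · exact (isZero_constOn_obj hk).eq_of_src _ _

instance projective_constOn_Iic [Projective M] : Projective (constOn (Set.Iic j) M) where
  factors {E X} f e he := by
    have : Epi (e.app (op j)) := inferInstance
    obtain ⟨g, hg⟩ := exists_constOn_Iic_hom (X := E) (Projective.factorThru
      ((constOnIso (Set.Iic j) M (Set.self_mem_Iic)).inv ≫ f.app (op j)) (e.app (op j)))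
    refine ⟨g, constOn_Iic_hom_ext ?_⟩
    rw [← cancel_epi (constOnIso (Set.Iic j) M (Set.self_mem_Iic)).inv, NatTrans.comp_app,
      reassoc_of% hg, Projective.factorThru_comp]

/-- The branches of the cover must be projective too, so that evaluating the presentation at `j`
allows dimension shifting in `C`. -/
lemma exists_projectivePresentation [EnoughProjectives C] (X : MorCat n C) :
    ∃ (P : MorCat n C) (p : P ⟶ X), Projective P ∧ Epi p ∧ ∀ k, Projective (P.obj k) := by
  have : HasFiniteBiproducts (MorCat n C) := Abelian.hasFiniteBiproducts
  let Q (j : Fin n) : MorCat n C := constOn (Set.Iic j) (Projective.over (X.obj (op j)))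
  choose q hq using fun j : Fin n => exists_constOn_Iic_hom (Projective.π (X.obj (op j)))
  refine ⟨⨁ Q, biproduct.desc q, ?_, ?_, fun k => ?_⟩
  · have (j : Fin n) : Projective (Q j) := projective_constOn_Iic
    exact ⟨fun f e _ => ⟨biproduct.desc fun b => Projective.factorThru (biproduct.ι Q b ≫ f) e,
      biproduct.hom_ext' _ _ fun b => by simp⟩⟩
  · rw [NatTrans.epi_iff_epi_app]
    rintro ⟨j⟩
    have h := hq j
    rw [← biproduct.ι_desc q j, NatTrans.comp_app, ← Category.assoc] at h
    exact epi_of_epi_fac h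
  -- A branch of the biproduct is not literally a biproduct of branches: the identity is decomposed
  -- as the sum of the evaluated `π` followed by `ι`, and the lifts on the summands are added.
  · refine ⟨fun {E Y} f e _ => ?_⟩
    choose φ hφ using fun j : Fin n =>
      (projective_constOn_obj k : Projective ((Q j).obj k)).factors
        ((biproduct.ι Q j).app k ≫ f) e
    refine ⟨∑ j, (biproduct.π Q j).app k ≫ φ j, ?_⟩
    rw [Preadditive.sum_comp]
    simp only [Category.assoc, hφ]
    simp only [← NatTrans.comp_app_assoc]
    rw [← Preadditive.sum_comp, ← NatTrans.app_sum, biproduct.total, NatTrans.id_app,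
      Category.id_comp]

end UniversalProperties

section Ext

open Abelian

variable [Abelian C] [EnoughProjectives C]

/-- Dimension shifting along a presentation and its evaluation at `j` reduces to degree 1, where the
adjunction matches the two extension problems. Only vanishing is compared, so no isomorphism of Ext
groups is needed. -/
lemma subsingleton_ext_constOn_Ici_iff [HasExt.{w} C] [HasExt.{w'} (MorCat n C)] (j : Fin n)
    (M : C) (k : ℕ) (X : MorCat n C) :
    Subsingleton (Ext.{w'} X (constOn (Set.Ici j) M) (k + 1)) ↔
      Subsingleton (Ext.{w} (X.obj (op j)) M (k + 1)) := by
  induction k generalizing X with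
  | zero =>
    obtain ⟨P, p, hP, hp, hP'⟩ := exists_projectivePresentation X
    have hS : (ShortComplex.mk (kernel.ι p) p (kernel.condition p)).ShortExact :=
      { exact := ShortComplex.exact_kernel p }
    have hSj := hS.map_of_exact ((evaluation _ C).obj (op j))
    have hP' := hP' (op j)
    rw [subsingleton_ext_one_iff_extendsAlong hS (Ext.subsingleton_of_projective P _ 0)]
    refine Iff.trans ?_ (subsingleton_ext_one_iff_extendsAlong hSj
      (Ext.subsingleton_of_projective (P.obj (op j)) M 0)).symm
    constructor
    · intro h f
      obtain ⟨g, rfl⟩ := exists_hom_constOn_Ici f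
      obtain ⟨g', rfl⟩ := h g
      exact ⟨g'.app (op j) ≫ (constOnIso (Set.Ici j) M Set.self_mem_Ici).hom,
        (Category.assoc _ _ _).symm⟩
    · intro h g
      obtain ⟨f, hf⟩ := h (g.app (op j) ≫ (constOnIso (Set.Ici j) M Set.self_mem_Ici).hom)
      obtain ⟨g', rfl⟩ := exists_hom_constOn_Ici f
      refine ⟨g', hom_constOn_Ici_ext ?_⟩
      rw [← cancel_mono (constOnIso (Set.Ici j) M Set.self_mem_Ici).hom]
      exact (Category.assoc _ _ _).trans hf
  | succ k ih =>
    obtain ⟨P, p, hP, hp, hP'⟩ := exists_projectivePresentation X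
    have hS : (ShortComplex.mk (kernel.ι p) p (kernel.condition p)).ShortExact :=
      { exact := ShortComplex.exact_kernel p }
    have hSj := hS.map_of_exact ((evaluation _ C).obj (op j))
    have hP' := hP' (op j)
    refine (subsingleton_ext_succ_iff hS (add_comm 1 (k + 1))
      (Ext.subsingleton_of_projective P _ _) (Ext.subsingleton_of_projective P _ _)).trans
      ((ih _).trans (subsingleton_ext_succ_iff hSj (add_comm 1 (k + 1))
        (Ext.subsingleton_of_projective (P.obj (op j)) M _)
        (Ext.subsingleton_of_projective (P.obj (op j)) M _)).symm)

lemma leftPerp_constOn_Ici_iff (j : Fin n) (M : C) (X : MorCat n C) :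
    leftPerp (constOn (Set.Ici j) M) X ↔ leftPerp M (X.obj (op j)) := by
  let : HasExt.{max u v} C := HasExt.standard C
  let : HasExt.{max u v} (MorCat n C) := HasExt.standard (MorCat n C)
  constructor
  all_goals
    intro h k hk
    obtain ⟨k, rfl⟩ := Nat.exists_eq_add_of_le' hk
  · exact (subsingleton_ext_constOn_Ici_iff j M k X).1 (h _ hk)
  · exact (subsingleton_ext_constOn_Ici_iff j M k X).2 (h _ hk)

end Ext

end MorCat

namespace MorCat

open Opposite

variable {n : ℕ} {C : Type u} [Category.{v} C]

lemma shortExact_of_forall_evaluation [Abelian C] {S : ShortComplex (MorCat n C)}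
    (h : ∀ k, (S.map ((evaluation _ C).obj k)).ShortExact) : S.ShortExact where
  exact := by
    rw [ShortComplex.exact_iff_isZero_homology, Functor.isZero_iff]
    intro k
    exact ((S.map ((evaluation _ C).obj k)).exact_iff_isZero_homology.1 (h k).exact).of_iso
      (S.mapHomologyIso ((evaluation _ C).obj k)).symm
  mono_f := by
    rw [NatTrans.mono_iff_mono_app]
    exact fun k => (h k).mono_f
  epi_g := by
    rw [NatTrans.epi_iff_epi_app]
    exact fun k => (h k).epi_g

/-! ### Perpendicularity to `m(M)` and `p(M)`. -/

section SplitConstOn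

variable [Abelian C] {j j' : Fin n} {M : C} [NeZero n]

omit [NeZero n] in
lemma constOnIso_naturality {X : MorCat n C} {i j : Fin n} (hij : i ≤ j)
    (f : X ⟶ constOn (Set.Ici i) M) :
    X.trans hij ≫ f.app (op i) ≫ (constOnIso (Set.Ici i) M Set.self_mem_Ici).hom =
      f.app (op j) ≫ (constOnIso (Set.Ici i) M hij).hom := by
  rw [trans, f.naturality_assoc, constOn_map (S := Set.Ici i) hij Set.self_mem_Ici,
    Category.assoc, Iso.inv_hom_id, Category.comp_id]

variable (M) in
/-- The short exact sequence relating the places up to `j`, all places, and the places from the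
successor `j'` of `j` on. -/
lemma exists_shortExact_constOn (hj : j ⋖ j') :
    ∃ (f : constOn (Set.Iic j) M ⟶ constOn (Set.Ici 0) M)
      (g : constOn (Set.Ici (0 : Fin n)) M ⟶ constOn (Set.Ici j') M) (h : f ≫ g = 0),
      g.app (op j') ≫ (constOnIso (Set.Ici j') M Set.self_mem_Ici).hom =
        (constOnIso (Set.Ici 0) M (Set.mem_Ici.2 (Fin.zero_le j'))).hom ∧
      (ShortComplex.mk f g h).ShortExact := by
  obtain ⟨f, hf⟩ := exists_constOn_Iic_hom (X := constOn (Set.Ici 0) M) (j := j)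
    (constOnIso (Set.Ici 0) M (Set.mem_Ici.2 (Fin.zero_le j))).inv
  obtain ⟨g, hg⟩ := exists_hom_constOn_Ici (X := constOn (Set.Ici 0) M) (j := j')
    (constOnIso (Set.Ici 0) M (Set.mem_Ici.2 (Fin.zero_le j'))).hom
  -- `f` is invertible at `j` by construction; naturality transports this to the lower places.
  -- Likewise `g` is transported from `j'` upwards.
  have hf' (k : Fin n) (hk : k ∈ Set.Iic j) : IsIso (f.app (op k)) := by
    have h := f.naturality (homOfLE hk).op
    rw [constOn_map Set.self_mem_Iic hk,
      constOn_map (Set.mem_Ici.2 (Fin.zero_le j)) (Set.mem_Ici.2 (Fin.zero_le k)),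
      Category.assoc, ← cancel_epi (constOnIso (Set.Iic j) M Set.self_mem_Iic).inv,
      Iso.inv_hom_id_assoc, reassoc_of% hf, Iso.inv_hom_id_assoc] at h
    exact IsIso.of_isIso_fac_left h
  have hg' (k : Fin n) (hk : k ∈ Set.Ici j') : IsIso (g.app (op k)) := by
    have h := constOnIso_naturality (Set.mem_Ici.1 hk) g
    rw [hg, trans, constOn_map (Set.mem_Ici.2 (Fin.zero_le k)) (Set.mem_Ici.2 (Fin.zero_le j')),
      Category.assoc, Iso.inv_hom_id, Category.comp_id] at h
    exact IsIso.of_isIso_fac_right h.symm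
  refine ⟨f, g, hom_constOn_Ici_ext ((isZero_constOn_obj ?_).eq_of_src _ _), hg,
    shortExact_of_forall_evaluation ?_⟩
  · simpa using hj.lt
  -- As `j'` covers `j`, each place has `k ≤ j` or `j' ≤ k`: one outer term is zero and the other
  -- map is an isomorphism.
  · rintro ⟨k⟩
    by_cases hk : k ≤ j
    · have h3 : IsZero ((constOn (Set.Ici j') M).obj (op k)) :=
        isZero_constOn_obj (by simpa using hk.trans_lt hj.lt)
      have := hf' k hk
      exact {
        exact := (ShortComplex.exact_iff_epi _ (h3.eq_of_tgt _ _)).2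
          (inferInstanceAs (Epi (f.app (op k))))
        mono_f := inferInstanceAs (Mono (f.app (op k)))
        epi_g := ⟨fun _ _ _ => h3.eq_of_src _ _⟩ }
    · have h1 : IsZero ((constOn (Set.Iic j) M).obj (op k)) := isZero_constOn_obj hk
      have := hg' k (hj.ge_of_gt (not_le.1 hk))
      exact {
        exact := (ShortComplex.exact_iff_mono _ (h1.eq_of_src _ _)).2
          (inferInstanceAs (Mono (g.app (op k))))
        mono_f := ⟨fun _ _ _ => h1.eq_of_tgt _ _⟩
        epi_g := inferInstanceAs (Epi (g.app (op k))) }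

variable [EnoughProjectives C] {X : MorCat n C}

/-- By adjunction, lifting a morphism through `constOn (Set.Ici 0) M ⟶ constOn (Set.Ici j') M` is
extending a map from the branch at `j'` to the branch at `0`. -/
lemma leftPerp_mAt_iff (hX : ∀ k, leftPerp M (X.obj (op k))) (hj : j ⋖ j') :
    leftPerp (mAt j M) X ↔ ExtendsAlong M (X.trans (Fin.zero_le j')) := by
  obtain ⟨f, g, h, hg, hS⟩ := exists_shortExact_constOn M hj
  have key (a : X ⟶ constOn (Set.Ici 0) M) :
      X.trans (Fin.zero_le j') ≫ a.app (op 0) ≫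
        (constOnIso (Set.Ici 0) M Set.self_mem_Ici).hom =
      (a ≫ g).app (op j') ≫ (constOnIso (Set.Ici j') M Set.self_mem_Ici).hom := by
    rw [constOnIso_naturality, NatTrans.comp_app, Category.assoc, hg]
  refine (leftPerp.iff_lifts hS ((leftPerp_constOn_Ici_iff _ _ _).2 (hX 0))
    ((leftPerp_constOn_Ici_iff _ _ _).2 (hX j'))).trans ⟨fun hl b => ?_, fun he b => ?_⟩
  · obtain ⟨b, rfl⟩ := exists_hom_constOn_Ici b
    obtain ⟨a, rfl⟩ := hl b
    exact ⟨_, key a⟩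
  · obtain ⟨a, ha⟩ := he (b.app (op j') ≫ (constOnIso (Set.Ici j') M Set.self_mem_Ici).hom)
    obtain ⟨a, rfl⟩ := exists_hom_constOn_Ici a
    rw [key] at ha
    exact ⟨a, hom_constOn_Ici_ext ((cancel_mono _).1 ha)⟩

lemma leftPerp_mAt_of_isTop (hX : ∀ k, leftPerp M (X.obj (op k))) (hj : IsTop j) :
    leftPerp (mAt j M) X := by
  have h : Set.Iic j = Set.Ici 0 := by
    ext k
    simp [hj k]
  rw [mAt, constOn_congr h, leftPerp_constOn_Ici_iff]
  exact hX 0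

omit [NeZero n] in
lemma leftPerp_pSum_iff : leftPerp (pSum n M) X ↔ ∀ k, leftPerp M (X.obj (op k)) := by
  have : HasFiniteBiproducts (MorCat n C) := Abelian.hasFiniteBiproducts
  rw [pSum, leftPerp.biproduct_iff]
  simp only [pAt, leftPerp_constOn_Ici_iff]
  exact ⟨fun h k => by simpa using h k.rev, fun h k => h _⟩

/-- Extension along a composite forces extension along its first factor `X.mor j hj`; conversely,
extensions along the single morphisms compose by induction. The last summand is the constant object
and imposes nothing new. -/
lemma leftPerp_mSum_iff (hX : ∀ k, leftPerp M (X.obj (op k))) :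
    leftPerp (mSum n M) X ↔ ∀ (j : ℕ) (hj : j + 1 < n), ExtendsAlong M (X.mor j hj) := by
  have : HasFiniteBiproducts (MorCat n C) := Abelian.hasFiniteBiproducts
  have hcov (j : ℕ) (hj : j + 1 < n) :
      (⟨j, Nat.lt_of_succ_lt hj⟩ : Fin n) ⋖ ⟨j + 1, hj⟩ :=
    ⟨Nat.lt_succ_self j, fun k h h' => by
      simp only [Fin.lt_def] at h h'
      lia⟩
  have hcomp (j : ℕ) (hj : j + 1 < n) :
      X.trans (Fin.zero_le ⟨j + 1, hj⟩) =
        X.mor j hj ≫ X.trans (Fin.zero_le ⟨j, Nat.lt_of_succ_lt hj⟩) :=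
    X.map_comp _ _
  rw [mSum, leftPerp.biproduct_iff]
  constructor
  · intro h j hj
    have := (leftPerp_mAt_iff hX (hcov j hj)).1 (h _)
    rw [hcomp] at this
    exact this.of_comp
  · rintro h ⟨j, hj⟩
    by_cases hj' : j + 1 < n
    · rw [leftPerp_mAt_iff hX (hcov j hj')]
      clear hj
      induction j with
      | zero => exact h 0 hj'
      | succ j ih =>
        rw [hcomp]
        exact (h _ hj').comp (ih (by lia))
    · refine leftPerp_mAt_of_isTop hX fun k => ?_
      simp only [Fin.le_def]
      lia

/-- The description of the monomorphism category of `^⊥T` by perpendicularity, for an injective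
cogenerator `I`. -/
theorem monoCat_leftPerp_eq (T : C) {I : C} [Injective I]
    (hI : ∀ {Y Z : C} (f : Y ⟶ Z), ExtendsAlong I f → Mono f) :
    monoCat n (leftPerp T) =
      leftPerp (mSum n T) ⊓ leftPerp (pSum n T) ⊓ leftPerp (mSum n I) := by
  have hmono {Y Z : C} (f : Y ⟶ Z) : ExtendsAlong I f ↔ Mono f :=
    ⟨hI f, fun _ g => Injective.factors g f⟩
  ext X
  change _ ↔ (leftPerp (mSum n T) X ∧ leftPerp (pSum n T) X) ∧ leftPerp (mSum n I) X
  -- Everything is perpendicular to the injective `I`, so the criterion applies to `m(I)` without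
  -- any condition on the branches.
  rw [leftPerp_mSum_iff fun k => leftPerp.of_injective _ I, leftPerp_pSum_iff]
  simp only [hmono]
  have hcoker (h : ∀ k, leftPerp T (X.obj (op k))) (j : ℕ) (hj : j + 1 < n)
      (hm : Mono (X.mor j hj)) :
      leftPerp T (cokernel (X.mor j hj)) ↔ ExtendsAlong T (X.mor j hj) :=
    leftPerp.iff_extendsAlong (S := ShortComplex.mk _ _ (cokernel.condition (X.mor j hj)))
      { exact := ShortComplex.exact_cokernel _ } (h _) (h _)
  constructor
  · rintro ⟨h₁, h₂⟩
    have hX (k : Fin n) : leftPerp T (X.obj (op k)) := h₁ k k.2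
    exact ⟨⟨(leftPerp_mSum_iff hX).2 fun j hj =>
      (hcoker hX j hj (h₂ j hj).1).1 (h₂ j hj).2, hX⟩, fun j hj => (h₂ j hj).1⟩
  · rintro ⟨⟨h₁, hX⟩, h₂⟩
    exact ⟨fun j hj => hX _, fun j hj => ⟨h₂ j hj, (hcoker hX j hj (h₂ j hj)).2
      ((leftPerp_mSum_iff hX).1 h₁ j hj)⟩⟩

end SplitConstOn

end MorCat

/-! ### Finitely generated modules, and `D(A_A)` as an injective cogenerator. -/

namespace FGModuleCat

variable {A : Type u} [Ring A] [IsNoetherianRing A]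

lemma mono_of_injective {X Y : FGModuleCat.{u} A} (f : X ⟶ Y) (h : Function.Injective f.hom.hom) :
    Mono f :=
  (forget₂ (FGModuleCat A) (ModuleCat A)).mono_of_mono_map ((ModuleCat.mono_iff_injective _).2 h)

lemma epi_of_surjective {X Y : FGModuleCat.{u} A} (f : X ⟶ Y)
    (h : Function.Surjective f.hom.hom) : Epi f :=
  (forget₂ (FGModuleCat A) (ModuleCat A)).epi_of_epi_map ((ModuleCat.epi_iff_surjective _).2 h)

lemma injective_of_mono {X Y : FGModuleCat.{u} A} (f : X ⟶ Y) [Mono f] :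
    Function.Injective f.hom.hom :=
  (ModuleCat.mono_iff_injective ((forget₂ (FGModuleCat A) (ModuleCat A)).map f)).1 inferInstance

instance : EnoughProjectives (FGModuleCat.{u} A) where
  presentation X := by
    obtain ⟨m, f, hf⟩ := Module.Finite.exists_fin' A X
    exact ⟨{
      p := FGModuleCat.of A (Fin m → A)
      projective := (forget₂ (FGModuleCat A) (ModuleCat A)).projective_of_map_projective
        (P := FGModuleCat.of A (Fin m → A))
        (inferInstanceAs (Projective (ModuleCat.of A (Fin m → A))))
      f := FGModuleCat.ofHom f
      epi := epi_of_surjective _ hf }⟩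

end FGModuleCat

namespace IsInjectiveEnvelope

variable {R E : Type u} [CommRing R] [IsArtinianRing R] [AddCommGroup E] [Module R E]
  {ι : (R ⧸ Ring.jacobson R) →ₗ[R] E}

/-- An injective envelope of `R / rad R` is a cogenerator. -/
lemma exists_linearMap_ne_zero (hι : IsInjectiveEnvelope ι) {X : Type u} [AddCommGroup X]
    [Module R X] {x : X} (hx : x ≠ 0) : ∃ f : X →ₗ[R] E, f x ≠ 0 := by
  let φ : (R ⧸ LinearMap.ker (LinearMap.toSpanSingleton R X x)) →ₗ[R] X :=
    (LinearMap.ker (LinearMap.toSpanSingleton R X x)).liftQ (LinearMap.toSpanSingleton R X x) le_rfl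
  have hφ : Function.Injective φ := LinearMap.ker_eq_bot.1 (Submodule.ker_liftQ_eq_bot _ _ _ le_rfl)
  -- The annihilator of `x` lies in a maximal ideal `m`, and the simple module `R ⧸ m` embeds in the
  -- semisimple `R ⧸ rad R`. The map `Rx → R ⧸ m → R ⧸ rad R → E` is nonzero at `x` and extends to
  -- `X` by injectivity of `E`.
  obtain ⟨m, hm, hle⟩ := Ideal.exists_le_maximal (LinearMap.ker (LinearMap.toSpanSingleton R X x))
    fun h => hx (by simpa using (Ideal.eq_top_iff_one _).1 h)
  have : IsSemisimpleModule R (R ⧸ Ring.jacobson R) :=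
    (IsArtinian.isSemisimpleModule_iff_jacobson R _).2 (Module.jacobson_quotient_jacobson R R)
  obtain ⟨s, hs⟩ := IsSemisimpleModule.lifting_property
    (Submodule.factor (Ring.jacobson_le_of_isMaximal m)) (Submodule.factor_surjective _)
    (LinearMap.id : (R ⧸ m) →ₗ[R] R ⧸ m)
  have hs' : Function.Injective s :=
    Function.LeftInverse.injective (g := Submodule.factor (Ring.jacobson_le_of_isMaximal m))
      (LinearMap.congr_fun hs)
  obtain ⟨f, hf⟩ := hι.isInjective.out φ hφ (ι ∘ₗ s ∘ₗ Submodule.factor hle)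
  have h1 := hf (Submodule.Quotient.mk 1)
  have h2 : φ (Submodule.Quotient.mk 1) = x :=
    (Submodule.liftQ_apply _ _ _).trans (one_smul R x)
  rw [h2] at h1
  refine ⟨f, fun h => ?_⟩
  rw [h1] at h
  have h3 : (Submodule.Quotient.mk 1 : R ⧸ m) = 0 :=
    (map_eq_zero_iff s hs').1 ((map_eq_zero_iff ι hι.injective).1 h)
  exact (Ideal.ne_top_iff_one m).1 hm.ne_top ((Submodule.Quotient.mk_eq_zero m).1 h3)

end IsInjectiveEnvelope

namespace DualRegular

variable {R A E : Type u} [CommRing R] [Ring A] [Algebra R A] [AddCommGroup E] [Module R E]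

/-- An `R`-linear map `X → E` yields an `A`-linear map `X → Hom_R(A, E)`. -/
def lift {X : Type u} [AddCommGroup X] [Module A X] [Module R X] [IsScalarTower R A X]
    (f : X →ₗ[R] E) : X →ₗ[A] DualRegular R A E where
  toFun x := f ∘ₗ (LinearMap.toSpanSingleton A X x).restrictScalars R
  map_add' x y := LinearMap.ext fun a =>
    (congrArg f (smul_add a x y)).trans (map_add f (a • x) (a • y))
  map_smul' b x := LinearMap.ext fun a => congrArg f (smul_smul a b x)

/-- Evaluation at `1`. -/
def evalOne {X : Type u} [AddCommGroup X] [Module A X] [Module R X] [IsScalarTower R A X]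
    (g : X →ₗ[A] DualRegular R A E) : X →ₗ[R] E where
  toFun x := (show A →ₗ[R] E from g x) 1
  map_add' x y := by
    rw [map_add]
    rfl
  map_smul' r x := by
    rw [← algebraMap_smul A r x, map_smul]
    change (show A →ₗ[R] E from g x) (1 * algebraMap R A r) = r • _
    rw [one_mul, Algebra.algebraMap_eq_smul_one, map_smul]

/-- An `A`-linear `g` is determined by its values at `1`, since `(g x)(a) = (a • g x)(1) = g (a • x)
(1)`. -/
lemma lift_evalOne {X : Type u} [AddCommGroup X] [Module A X] [Module R X] [IsScalarTower R A X]
    (g : X →ₗ[A] DualRegular R A E) : lift (evalOne g) = g := by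
  ext x
  refine LinearMap.ext fun a => ?_
  change (show A →ₗ[R] E from g (a • x)) 1 = (show A →ₗ[R] E from g x) a
  rw [map_smul]
  change (show A →ₗ[R] E from g x) (1 * a) = _
  rw [one_mul]

end DualRegular

section

variable {R A E : Type u} [CommRing R] [IsArtinianRing R] [Ring A] [Algebra R A]
  [Module.Finite R A] [AddCommGroup E] [Module R E] {ι : (R ⧸ Ring.jacobson R) →ₗ[R] E}
  (hι : IsInjectiveEnvelope ι)

/-- `D(A_A)` is injective. -/
lemma injective_dualRegular : Injective (dualRegular A hι) where
  factors {X Y} g f hf := by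
    have := isNoetherianRing_of_artinAlgebra R A
    have := DualRegular.finite (A := A) hι
    let : Module R X := Module.compHom X (algebraMap R A)
    have : IsScalarTower R A X := .of_algebraMap_smul fun _ _ => rfl
    let : Module R Y := Module.compHom Y (algebraMap R A)
    have : IsScalarTower R A Y := .of_algebraMap_smul fun _ _ => rfl
    have hinj := FGModuleCat.injective_of_mono f
    -- The extension problem over `A` becomes one for `R`-linear maps into the injective `E`; the
    -- solution is carried back by `lift`.
    obtain ⟨h, hh⟩ := hι.isInjective.out (f.hom.hom.restrictScalars R) hinj
      (DualRegular.evalOne (R := R) (E := E) g.hom.hom)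
    refine ⟨FGModuleCat.ofHom (DualRegular.lift h), ?_⟩
    ext x
    refine LinearMap.ext fun a => ?_
    change h (a • f.hom.hom x) = _
    rw [← map_smul]
    refine (hh _).trans ?_
    exact LinearMap.congr_fun (LinearMap.congr_fun (DualRegular.lift_evalOne g.hom.hom) x) a

/-- `D(A_A)` is a cogenerator. -/
lemma mono_of_extendsAlong_dualRegular {X Y : FGModuleCat.{u} A} (f : X ⟶ Y)
    (hf : ExtendsAlong (dualRegular A hι) f) : Mono f := by
  have := isNoetherianRing_of_artinAlgebra R A
  have := DualRegular.finite (A := A) hι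
  refine FGModuleCat.mono_of_injective f ((injective_iff_map_eq_zero _).2 fun x hx => ?_)
  by_contra hx0
  let : Module R X := Module.compHom X (algebraMap R A)
  have : IsScalarTower R A X := .of_algebraMap_smul fun _ _ => rfl
  -- If `f` kills `x`, then so does `lift p`, which factors through `f`; evaluating at `1`
  -- contradicts `p x ≠ 0`.
  obtain ⟨p, hp⟩ := hι.exists_linearMap_ne_zero hx0
  obtain ⟨h, hh⟩ := hf (FGModuleCat.ofHom (DualRegular.lift p))
  apply hp
  have h1 : h.hom.hom (f.hom.hom x) = DualRegular.lift p x :=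
    congrArg (fun q => q.hom.hom x) hh
  rw [hx, map_zero] at h1
  have h2 : 0 = p ((1 : A) • x) := LinearMap.congr_fun h1 1
  rw [← h2.symm, one_smul]

end

theorem proposition3p6 (R A : Type u) [CommRing R] [IsArtinianRing R] [Ring A] [Algebra R A]
    [Module.Finite R A] (E : Type u) [AddCommGroup E] [Module R E]
    (ι : (R ⧸ Ring.jacobson R) →ₗ[R] E) (hι : IsInjectiveEnvelope ι)
    (n : ℕ) (hn : 2 ≤ n) (T : FGModuleCat.{u} A) :
    haveI : IsNoetherianRing A := isNoetherianRing_of_artinAlgebra R A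
    MorCat.monoCat n (leftPerp T) =
      leftPerp (MorCat.mSum n T) ⊓ leftPerp (MorCat.pSum n T) ⊓
        leftPerp (MorCat.mSum n (dualRegular A hι)) := by
  have : IsNoetherianRing A := isNoetherianRing_of_artinAlgebra R A
  have : NeZero n := ⟨by lia⟩
  have := injective_dualRegular (A := A) hι
  exact MorCat.monoCat_leftPerp_eq T (mono_of_extendsAlong_dualRegular hι)
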